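/- Theorem 16. Let $(X,\rho)$ be an infinite separable locally compact metric space and let $f:X\to X$ be a continuous (topologically) mixing map, i.e. for all nonempty open $U,V\subset X$ there is $N$ with $f^n(U)\cap V\neq\emptyset$ for all $n\ge N$. Let $\beta=\infty$ if $X$ is unbounded and $\beta=\operatorname{diam}(X)$ if $X$ is bounded, and let $\delta=\inf_{n\ge1}\sup_{x\in X}\rho(f^n(x),x)\in[0,\infty]$. Let $\mathcal M$ be an infinite set of positive integers, let $v_1,v_2,\dots$ be a sequence of points of $X$, and let $x_1,x_2,\dots$ be a sequence of points of $X$ each of which has an $\omega$-limit point in $X$ (repetitions are allowed in both sequences). Terminology. A *Cantor set* is a nonempty compact, perfect, totally disconnected set. A point is *totally transitive* if its orbit under $f^n$ is dense in $X$ for every $n\ge1$. A set $C\subset X$ is *$\mathcal M$-synchronously proximal* to $v$ if there are $m_1<m_2<\cdots$ in $\mathcal M$ with $\operatorname{diam}(f^{m_i}(C)\cup\{v\})\to0$, and *dynamically synchronously proximal* to $v$ if there are positive integers $n_1<n_2<\cdots$ with $\operatorname{diam}(f^{n_i}(C\cup\{v\}))\to0$. For $0<\gamma\le\infty$, a set $S$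 with at least two points is *$\gamma$-scrambled* for a map $g$ (with respect to $\mathcal M$, respectively) if for all distinct $x,y\in S$ one has $\liminf\rho(g^n(x),g^n(y))=0$ and $\limsup\rho(g^n(x),g^n(y))\ge\gamma$ as $n\to\infty$ (as $n\to\infty$ with $n\in\mathcal M$, respectively). A set $A$ is *invariant* under $g$ if $g(A)\subset A$. Then $\delta>0$, and there are pairwise disjoint Cantor sets $S^{(1)},S^{(2)},\dots$ of totally transitive points of $f$ such that, with $\mathbb S=\bigcup_{j\ge1}S^{(j)}$ and $\widehat{\mathbb S}=\bigcup_{i\ge0}f^i(\mathbb S)$: (1) each nonempty open subset of $X$ contains infinitely many of the sets $S^{(j)}$; (2) for each $\ell\ge1$, the set $\bigcup_{j=1}^{\ell}S^{(j)}$ is $\mathcal M$-synchronously proximal to $v_m$ for each $m\ge1$, and dynamically synchronously proximal to $f^i(x_m)$ for all $m\ge1$, $i\ge0$; (3) $\mathbb S$ is dense in $X$ and is a $\beta$-scrambled set of $f$ with respect to $\mathcal M$; (4) for every $x\in\bigcup_{i\ge0}f^i(\{x_1,x_2,\dots\})$ and every $c\in\widehat{\mathbb S}$, $\liminf_{n\to\infty}\rho(f^n(x),f^n(c))=0$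 and $\limsup_{n\to\infty}\rho(f^n(x),f^n(c))\ge\beta/2$, i.e. $\{x,c\}$ is a $(\beta/2)$-scrambled set of $f$; (5) for all $c\ne d$ in $\mathbb S$ and all $i\ge0$, $\limsup_{n\to\infty,\,n\in\mathcal M}\rho(f^n(f^i(c)),f^n(f^i(d)))=\beta$. Furthermore, if $f$ has a fixed point, then the Cantor sets can be chosen so that (1)–(5) hold and, in addition, $\widehat{\mathbb S}$ is a dense invariant $\delta$-scrambled set of $f$ with respect to $\mathcal M$. Consequently, if $f$ has a fixed point, then for $\mathcal M=\{n!:n\ge1\}$ the Cantor sets can be chosen so that (1)–(5) hold and, for every $n\ge1$, $\mathbb S$ is a dense $\beta$-scrambled set of $f^n$ and $\widehat{\mathbb S}$ is a dense subset of $X$ that is invariant under $f^n$ and $\delta$-scrambled for $f^n$. -/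

import Mathlib

open Set Filter Topology
open scoped ENNReal

noncomputable section

namespace MixingChaos

variable {X : Type*} [MetricSpace X]

/-- Topological mixing of a self-map. -/
def IsMixing (f : X → X) : Prop :=
  ∀ U V : Set X, IsOpen U → U.Nonempty → IsOpen V → V.Nonempty →
    ∃ N : ℕ, ∀ n ≥ N, (f^[n] '' U ∩ V).Nonempty

/-- The orbit `x, f x, f (f x), …` is dense. -/
def IsTransitivePoint (f : X → X) (x : X) : Prop :=
  Dense (range fun i : ℕ => f^[i] x)

/-- `x` is a transitive point of every iterate `f^n`, `n ≥ 1`. -/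
def IsTotallyTransitivePoint (f : X → X) (x : X) : Prop :=
  ∀ n : ℕ, 1 ≤ n → IsTransitivePoint (f^[n]) x

/-- `y` is a limit of a subsequence of the orbit of `x`. -/
def IsOmegaLimitPoint (f : X → X) (x y : X) : Prop :=
  ∃ n : ℕ → ℕ, StrictMono n ∧ Tendsto (fun i => f^[n i] x) atTop (𝓝 y)

/-- A (nonempty) Cantor set. -/
structure IsCantorSet (C : Set X) : Prop where
  nonempty : C.Nonempty
  compact : IsCompact C
  perfect : Perfect C
  totallyDisconnected : IsTotallyDisconnected C

/-- `C` is `M`-synchronously proximal to `v` under `f`. -/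
def IsSyncProximal (f : X → X) (M : Set ℕ) (C : Set X) (v : X) : Prop :=
  ∃ m : ℕ → ℕ, StrictMono m ∧ (∀ i, m i ∈ M) ∧
    Tendsto (fun i => Metric.ediam (f^[m i] '' C ∪ {v})) atTop (𝓝 0)

/-- `C` is dynamically synchronously proximal to `v` under `f`. -/
def IsDynSyncProximal (f : X → X) (C : Set X) (v : X) : Prop :=
  ∃ n : ℕ → ℕ, StrictMono n ∧ (∀ i, 0 < n i) ∧
    Tendsto (fun i => Metric.ediam (f^[n i] '' (C ∪ {v}))) atTop (𝓝 0)

/-- The filter of `n → ∞` with `n ∈ M`. -/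
def atTopIn (M : Set ℕ) : Filter ℕ := atTop ⊓ 𝓟 M

/-- `liminf ρ(fⁿ x, fⁿ y) = 0` and `limsup ρ(fⁿ x, fⁿ y) ≥ β` along the filter `l`; for `β = ∞`
the second condition says that the limsup is `∞`. -/
def IsScrambledPair (f : X → X) (l : Filter ℕ) (β : ℝ≥0∞) (x y : X) : Prop :=
  liminf (fun n => edist (f^[n] x) (f^[n] y)) l = 0 ∧
    β ≤ limsup (fun n => edist (f^[n] x) (f^[n] y)) l

/-- `S` is a `β`-scrambled set of `f` (`0 < β ≤ ∞`). -/
def IsScrambled (f : X → X) (β : ℝ≥0∞) (S : Set X) : Prop :=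
  S.Nontrivial ∧ ∀ x ∈ S, ∀ y ∈ S, x ≠ y → IsScrambledPair f atTop β x y

/-- `S` is a `β`-scrambled set of `f` with respect to `M` (`0 < β ≤ ∞`). -/
def IsScrambledWrt (f : X → X) (M : Set ℕ) (β : ℝ≥0∞) (S : Set X) : Prop :=
  S.Nontrivial ∧ ∀ x ∈ S, ∀ y ∈ S, x ≠ y → IsScrambledPair f (atTopIn M) β x y

/-- `⋃_{i ≥ 0} f^i(A)`. -/
def invariantHull (f : X → X) (A : Set X) : Set X := ⋃ i : ℕ, f^[i] '' A

/-- The diameter of the space, equal to `∞` exactly if the space is unbounded. -/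
def spaceDiam (X : Type*) [MetricSpace X] : ℝ≥0∞ := Metric.ediam (univ : Set X)

/-- `inf_{n ≥ 1} sup_x ρ(fⁿ x, x)`. -/
def displacement (f : X → X) : ℝ≥0∞ := ⨅ n : ℕ, ⨅ _ : 1 ≤ n, ⨆ x : X, edist (f^[n] x) x

/-- `S 0, S 1, …` are pairwise disjoint Cantor sets of totally transitive points of `f` with the
listed properties relative to `M` and the points `v m`, `x m`. -/
structure IsScrambledCantorFamily (f : X → X) (M : Set ℕ) (v x : ℕ → X) (S : ℕ → Set X) :
    Prop where
  cantor : ∀ j, IsCantorSet (S j)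
  pairwise_disjoint : Pairwise fun i j => Disjoint (S i) (S j)
  totallyTransitive : ∀ j, ∀ p ∈ S j, IsTotallyTransitivePoint f p
  infinite_in_open : ∀ U : Set X, IsOpen U → U.Nonempty → {j | S j ⊆ U}.Infinite
  syncProximal : ∀ l m : ℕ, IsSyncProximal f M (⋃ j ≤ l, S j) (v m)
  dynSyncProximal : ∀ l m i : ℕ, IsDynSyncProximal f (⋃ j ≤ l, S j) (f^[i] (x m))
  dense : Dense (⋃ j, S j)
  scrambled : IsScrambledWrt f M (spaceDiam X) (⋃ j, S j)
  scrambled_with : ∀ p ∈ invariantHull f (range x), ∀ c ∈ invariantHull f (⋃ j, S j),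
    IsScrambledPair f atTop (spaceDiam X / 2) p c ∧ IsScrambled f (spaceDiam X / 2) {p, c}
  limsup_eq : ∀ c ∈ ⋃ j, S j, ∀ d ∈ ⋃ j, S j, c ≠ d → ∀ i : ℕ,
    limsup (fun n => edist (f^[n] (f^[i] c)) (f^[n] (f^[i] d))) (atTopIn M) = spaceDiam X

end MixingChaos

end

/-! The proof is a Baire category argument in the space of sequences `G : ℕ → C(ℕ → Bool, X)` of
parametrized candidate Cantor sets, a Baire space because `X` is Polish.

Given countably many infinite sets `A` of exponents, a generic `G` has this property for each of
them: whatever maps `φ j` are prescribed, infinitely many `n ∈ A` bring `f^[n] ∘ G j` uniformly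
close to `φ j` for all `j ≤ l` at once. Density is where mixing enters
(`IsMixing.exists_perturbation`): after a locally constant approximation only finitely many pairs of
balls have to be joined, and mixing joins them all by one exponent.

The dynamics then reduces to choosing `φ` and `A`. Constant `φ` give synchronous proximality and
dense orbits; two-valued `φ` separate distinct parameters, giving injectivity and limsup equal to
the diameter. Multiples of `n` as exponents give total transitivity, and times along which the orbit
of `f^[i] (x m)` converges give the statements about `x m`. Near a fixed point `z`, finitely many
further iterates stay near `z`, so liminfs vanish on the whole invariant hull. -/

namespace MixingChaos

/-! ### Polish and Baire spaces -/

open UniformSpace in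
/-- A locally compact metric space is open in its completion. -/
theorem isOpen_range_coe_completion (X : Type*) [MetricSpace X] [LocallyCompactSpace X] :
    IsOpen (range ((↑) : X → Completion X)) := by
  rw [isOpen_iff_mem_nhds]
  rintro _ ⟨x, rfl⟩
  obtain ⟨K, hK, hxK⟩ := exists_compact_mem_nhds x
  rw [(Completion.isUniformInducing_coe X).isInducing.nhds_eq_comap, mem_comap] at hxK
  obtain ⟨V, hV, hVK⟩ := hxK
  obtain ⟨W, hWV, hW, hxW⟩ := _root_.mem_nhds_iff.1 hV
  refine _root_.mem_nhds_iff.2 ⟨W, ?_, hW, hxW⟩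
  have hcl : IsClosed (((↑) : X → Completion X) '' K) :=
    (hK.image (Completion.continuous_coe X)).isClosed
  refine (Completion.denseRange_coe.open_subset_closure_inter hW).trans
    ((closure_minimal ?_ hcl).trans (image_subset_range _ _))
  rintro _ ⟨hyW, y, rfl⟩
  exact ⟨y, hVK (hWV hyW), rfl⟩

/-- A separable locally compact metric space is Polish. -/
theorem polishSpace_of_locallyCompact (X : Type*) [MetricSpace X] [LocallyCompactSpace X]
    [TopologicalSpace.SeparableSpace X] : PolishSpace X := by
  have : PolishSpace (range ((↑) : X → UniformSpace.Completion X)) :=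
    (isOpen_range_coe_completion X).polishSpace
  have e : X ≃ₜ range ((↑) : X → UniformSpace.Completion X) :=
    ((UniformSpace.Completion.isUniformInducing_coe X).isInducing.isEmbedding).toHomeomorph
  exact e.isClosedEmbedding.polishSpace

theorem baireSpace_pi_continuousMap (ι K X : Type*) [Countable ι] [TopologicalSpace K]
    [CompactSpace K] [TopologicalSpace X] [PolishSpace X] : BaireSpace (ι → C(K, X)) := by
  -- The given metric need not be complete, but the compact-open topology does not depend on the
  -- metric, so a complete one may be substituted.
  let _ := TopologicalSpace.upgradeIsCompletelyMetrizable X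
  infer_instance

/-! ### Locally constant approximation and perturbation under mixing -/

/-- A continuous function on the Cantor space is uniformly close to its composition with a
locally constant map of finite range. -/
theorem exists_locallyConstant_approx {Z : Type*} [PseudoMetricSpace Z] {h : (ℕ → Bool) → Z}
    (hh : Continuous h) {ε : ℝ} (hε : 0 < ε) :
    ∃ r : (ℕ → Bool) → (ℕ → Bool), IsLocallyConstant r ∧ (range r).Finite ∧
      ∀ t, dist (h (r t)) (h t) < ε := by
  have hcyl : ∀ t : ℕ → Bool, ∃ n, PiNat.cylinder t n ⊆ h ⁻¹' Metric.ball (h t) (ε / 2) := by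
    intro t
    obtain ⟨_, ⟨x, n, rfl⟩, htx, hsub⟩ :=
      (PiNat.isTopologicalBasis_cylinders (fun _ : ℕ => Bool)).exists_subset_of_mem_open
        (show t ∈ h ⁻¹' Metric.ball (h t) (ε / 2) by simp [hε])
        (Metric.isOpen_ball.preimage hh)
    exact ⟨n, (PiNat.mem_cylinder_iff_eq.1 htx) ▸ hsub⟩
  choose n hn using hcyl
  obtain ⟨F, -, hF⟩ := isCompact_univ.elim_nhds_subcover (fun t => PiNat.cylinder t (n t))
    fun t _ => (PiNat.isOpen_cylinder (fun _ : ℕ => Bool) t (n t)).mem_nhds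
      (PiNat.self_mem_cylinder t _)
  -- Keeping the first `s` bits and padding with `false` leaves every point in the cylinder of the
  -- finite cover that contains it.
  let s := F.sup n
  let e : (Fin s → Bool) → (ℕ → Bool) := fun w i => if hi : i < s then w ⟨i, hi⟩ else false
  let p : (ℕ → Bool) → (Fin s → Bool) := fun t i => t i
  have hp : Continuous p := by fun_prop
  refine ⟨e ∘ p, ((IsLocallyConstant.iff_continuous p).2 hp).comp e,
    (finite_range e).subset (range_comp_subset_range _ _), fun t => ?_⟩
  obtain ⟨u, huF, hu⟩ := mem_iUnion₂.1 (hF (mem_univ t))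
  have hru : e (p t) ∈ PiNat.cylinder u (n u) := by
    rw [PiNat.mem_cylinder_iff] at hu ⊢
    intro i hi
    have his : i < s := hi.trans_le (Finset.le_sup huF)
    simp [e, p, his, hu i hi]
  have h1 := hn u hu
  have h2 := hn u hru
  rw [mem_preimage, Metric.mem_ball] at h1 h2
  calc dist (h (e (p t))) (h t) ≤ dist (h (e (p t))) (h u) + dist (h t) (h u) :=
        dist_triangle_right _ _ _
    _ < ε := by linarith

theorem frequently_atTopIn {M : Set ℕ} {p : ℕ → Prop} :
    (∃ᶠ n in atTopIn M, p n) ↔ ∀ N, ∃ n ≥ N, n ∈ M ∧ p n := by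
  rw [atTopIn, frequently_inf_principal, frequently_atTop]

variable {X : Type*} [MetricSpace X] {f : X → X}

theorem IsMixing.eventually (hmix : IsMixing f) {U V : Set X} (hU : IsOpen U) (hU' : U.Nonempty)
    (hV : IsOpen V) (hV' : V.Nonempty) : ∀ᶠ n in atTop, ∃ x ∈ U, f^[n] x ∈ V := by
  obtain ⟨N, hN⟩ := hmix U V hU hU' hV hV'
  filter_upwards [eventually_ge_atTop N] with n hn
  obtain ⟨_, ⟨x, hx, rfl⟩, hxV⟩ := hN n hn
  exact ⟨x, hx, hxV⟩

/-- Under a mixing map, finitely many parametrized Cantor sets can be perturbed so that one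
iterate, with exponent in a given infinite set, carries them uniformly close to prescribed maps. -/
theorem IsMixing.exists_perturbation (hmix : IsMixing f)
    (G φ : ℕ → C(ℕ → Bool, X)) (I : Finset ℕ) {ε : ℝ} (hε : 0 < ε) {A : Set ℕ} (hA : A.Infinite)
    (N : ℕ) :
    ∃ n ≥ N, n ∈ A ∧ ∃ H : ℕ → C(ℕ → Bool, X), ∀ j ∈ I, dist (H j) (G j) < ε ∧
      ∀ t, dist (f^[n] (H j t)) (φ j t) < ε := by
  have hε2 := half_pos hε
  have : Nonempty X := ⟨G 0 fun _ => false⟩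
  -- One `r` serves all `G j` and `φ j` with `j ∈ I`, by treating them as a single map into a finite
  -- product.
  obtain ⟨r, hr, hfin, happ⟩ := exists_locallyConstant_approx
    (h := fun t (j : I) => (G j t, φ j t)) (by fun_prop) hε2
  have happ' : ∀ j ∈ I, ∀ t, dist (G j (r t)) (G j t) < ε / 2 ∧
      dist (φ j (r t)) (φ j t) < ε / 2 := by
    intro j hj t
    have := (dist_pi_lt_iff hε2).1 (happ t) ⟨j, hj⟩
    rwa [Prod.dist_eq, max_lt_iff] at this
  have hev : ∀ᶠ n in atTop, ∀ j ∈ I, ∀ w ∈ range r,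
      ∃ q ∈ Metric.ball (G j w) (ε / 2), f^[n] q ∈ Metric.ball (φ j w) (ε / 2) := by
    refine (Finset.eventually_all I).2 fun j _ => (hfin.eventually_all).2 fun w _ => ?_
    exact hmix.eventually Metric.isOpen_ball ⟨_, Metric.mem_ball_self hε2⟩ Metric.isOpen_ball
      ⟨_, Metric.mem_ball_self hε2⟩
  obtain ⟨n, hnA, hnN, hn⟩ := ((Nat.frequently_atTop_iff_infinite.2 hA).and_eventually
    ((eventually_ge_atTop N).and hev)).exists
  choose! q hq hq' using hn
  -- The choice `q j` need not be continuous; local constancy of `r` makes the composite so.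
  refine ⟨n, hnN, hnA, fun j => ⟨q j ∘ r, (hr.comp (q j)).continuous⟩,
    fun j hj => ⟨?_, fun t => ?_⟩⟩
  · refine (ContinuousMap.dist_lt_iff hε).2 fun t => ?_
    have h1 := Metric.mem_ball.1 (hq j hj (r t) ⟨t, rfl⟩)
    have h2 := (happ' j hj t).1
    calc dist (q j (r t)) (G j t) ≤ dist (q j (r t)) (G j (r t)) + dist (G j (r t)) (G j t) :=
          dist_triangle _ _ _
      _ < ε := by linarith
  · have h1 := Metric.mem_ball.1 (hq' j hj (r t) ⟨t, rfl⟩)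
    have h2 := (happ' j hj t).2
    calc dist (f^[n] (q j (r t))) (φ j t)
        ≤ dist (f^[n] (q j (r t))) (φ j (r t)) + dist (φ j (r t)) (φ j t) := dist_triangle _ _ _
      _ < ε := by linarith

/-! ### Generic sequences of maps -/

/-- Open sets of sequences of maps contain uniform neighbourhoods in finitely many coordinates. -/
theorem exists_finset_dist_subset {K : Type*} [TopologicalSpace K] [CompactSpace K]
    {O : Set (ℕ → C(K, X))} (hO : IsOpen O) {G : ℕ → C(K, X)} (hG : G ∈ O) :
    ∃ (I : Finset ℕ) (ε : ℝ), 0 < ε ∧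
      ∀ H : ℕ → C(K, X), (∀ j ∈ I, dist (H j) (G j) < ε) → H ∈ O := by
  obtain ⟨I, u, hu, hsub⟩ := isOpen_pi_iff.1 hO G hG
  have : ∀ᶠ ε in 𝓝[>] (0 : ℝ), ∀ j ∈ I, Metric.ball (G j) ε ⊆ u j := by
    refine (Finset.eventually_all I).2 fun j hj => ?_
    obtain ⟨ε, hε, hb⟩ := Metric.isOpen_iff.1 (hu j hj).1 (G j) (hu j hj).2
    filter_upwards [Ioo_mem_nhdsGT hε] with δ hδ
    exact (Metric.ball_subset_ball hδ.2.le).trans hb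
  obtain ⟨ε, hε, hpos⟩ := (this.and self_mem_nhdsWithin).exists
  exact ⟨I, ε, hpos, fun H hH => hsub fun j hj => hε j hj (hH j hj)⟩

/-- The set of sequences of maps whose first terms are carried close to `φ` by an iterate. -/
def shadowing (f : X → X) (A : Set ℕ) (φ : ℕ → C(ℕ → Bool, X)) (l N : ℕ) (ε : ℝ) :
    Set (ℕ → C(ℕ → Bool, X)) :=
  {G | ∃ n ≥ N, n ∈ A ∧ ∀ j ≤ l, ∀ t, dist (f^[n] (G j t)) (φ j t) < ε}

theorem isOpen_shadowing (hf : Continuous f) (A : Set ℕ) (φ : ℕ → C(ℕ → Bool, X)) (l N : ℕ)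
    {ε : ℝ} (hε : 0 < ε) : IsOpen (shadowing f A φ l N ε) := by
  have : shadowing f A φ l N ε = ⋃ n ∈ {n | N ≤ n ∧ n ∈ A}, ⋂ j ∈ Iic l,
      {G : ℕ → C(ℕ → Bool, X) |
        dist (ContinuousMap.comp ⟨f^[n], hf.iterate n⟩ (G j)) (φ j) < ε} := by
    ext G
    simp [shadowing, ContinuousMap.dist_lt_iff hε, and_assoc]
  rw [this]
  refine isOpen_biUnion fun n _ => (finite_Iic l).isOpen_biInter fun j _ => ?_
  exact isOpen_lt (((ContinuousMap.continuous_postcomp _).comp (continuous_apply j)).dist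
    continuous_const) continuous_const

theorem IsMixing.dense_shadowing (hmix : IsMixing f) {A : Set ℕ}
    (hA : A.Infinite) (φ : ℕ → C(ℕ → Bool, X)) (l N : ℕ) {ε : ℝ} (hε : 0 < ε) :
    Dense (shadowing f A φ l N ε) := by
  refine dense_iff_inter_open.2 fun O hO ⟨G, hG⟩ => ?_
  obtain ⟨I, δ, hδ, hI⟩ := exists_finset_dist_subset hO hG
  obtain ⟨n, hnN, hnA, H, hH⟩ := hmix.exists_perturbation G φ (I ∪ Finset.Iic l)
    (lt_min hδ hε) hA N
  refine ⟨H, hI H fun j hj => (hH j (by simp [hj])).1.trans_le (min_le_left _ _),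
    n, hnN, hnA, fun j hj t => ((hH j (by simp [hj])).2 t).trans_le (min_le_right _ _)⟩

theorem isOpen_exists_range_subset {U : Set X} (hU : IsOpen U) (N : ℕ) :
    IsOpen {G : ℕ → C(ℕ → Bool, X) | ∃ j ≥ N, range (G j) ⊆ U} := by
  have : {G : ℕ → C(ℕ → Bool, X) | ∃ j ≥ N, range (G j) ⊆ U} =
      ⋃ j ∈ Ici N, (fun G => G j) ⁻¹' {g : C(ℕ → Bool, X) | MapsTo g univ U} := by
    ext G
    simp [range_subset_iff, MapsTo]
  rw [this]
  exact isOpen_biUnion fun j _ =>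
    (ContinuousMap.isOpen_setOfPred_mapsTo isCompact_univ hU).preimage (continuous_apply j)

/-- An open condition constrains finitely many coordinates, so a later one can be replaced by a
constant map into `U`. -/
theorem dense_exists_range_subset {U : Set X} (hU : U.Nonempty) (N : ℕ) :
    Dense {G : ℕ → C(ℕ → Bool, X) | ∃ j ≥ N, range (G j) ⊆ U} := by
  refine dense_iff_inter_open.2 fun O hO ⟨G, hG⟩ => ?_
  obtain ⟨I, δ, hδ, hI⟩ := exists_finset_dist_subset hO hG
  obtain ⟨u, hu⟩ := hU
  obtain ⟨j, hj⟩ := Infinite.exists_notMem_finset (I ∪ Finset.range N)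
  simp only [Finset.mem_union, Finset.mem_range, not_or, not_lt] at hj
  refine ⟨Function.update G j (.const _ u), hI _ fun i hi => ?_, j, hj.2, ?_⟩
  · have hij : i ≠ j := by rintro rfl; exact hj.1 hi
    rw [Function.update_of_ne hij]
    simpa using hδ
  · rintro _ ⟨t, rfl⟩
    simpa using hu

/-- A generic sequence of maps from the Cantor space to `X`. -/
theorem IsMixing.exists_generic [LocallyCompactSpace X] [TopologicalSpace.SeparableSpace X]
    (hmix : IsMixing f) (hf : Continuous f) {𝒜 : Set (Set ℕ)}
    (h𝒜 : 𝒜.Countable) (hinf : ∀ A ∈ 𝒜, A.Infinite) [Nonempty X] :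
    ∃ G : ℕ → C(ℕ → Bool, X),
      (∀ U : Set X, IsOpen U → U.Nonempty → ∀ N, ∃ j ≥ N, range (G j) ⊆ U) ∧
      ∀ A ∈ 𝒜, ∀ (φ : ℕ → C(ℕ → Bool, X)) (l : ℕ) (ε : ℝ), 0 < ε →
        ∃ᶠ n in atTopIn A, ∀ j ≤ l, ∀ t, dist (f^[n] (G j t)) (φ j t) < ε := by
  have := polishSpace_of_locallyCompact X
  have := baireSpace_pi_continuousMap ℕ (ℕ → Bool) X
  have := h𝒜.to_subtype
  have hB := TopologicalSpace.countable_countableBasis X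
  have := hB.to_subtype
  have : Nonempty (ℕ → C(ℕ → Bool, X)) := ⟨fun _ => .const _ (Classical.arbitrary X)⟩
  let D := TopologicalSpace.denseSeq (ℕ → C(ℕ → Bool, X))
  have h1 := dense_iInter_of_isOpen
    (f := fun i : 𝒜 × ℕ × ℕ × ℕ × ℕ =>
      shadowing f i.1 (D i.2.1) i.2.2.1 i.2.2.2.1 (1 / ((i.2.2.2.2 : ℝ) + 1)))
    (fun i => isOpen_shadowing hf _ _ _ _ Nat.one_div_pos_of_nat)
    (fun i => hmix.dense_shadowing (hinf _ i.1.2) _ _ _ Nat.one_div_pos_of_nat)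
  have ho1 := IsGδ.iInter_of_isOpen
    (f := fun i : 𝒜 × ℕ × ℕ × ℕ × ℕ =>
      shadowing f i.1 (D i.2.1) i.2.2.1 i.2.2.2.1 (1 / ((i.2.2.2.2 : ℝ) + 1)))
    (fun i => isOpen_shadowing hf _ _ _ _ Nat.one_div_pos_of_nat)
  have h2 := dense_iInter_of_isOpen
    (f := fun i : TopologicalSpace.countableBasis X × ℕ =>
      {G : ℕ → C(ℕ → Bool, X) | ∃ j ≥ i.2, range (G j) ⊆ i.1})
    (fun i => isOpen_exists_range_subset (TopologicalSpace.isOpen_of_mem_countableBasis i.1.2) _)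
    (fun i => dense_exists_range_subset
      (TopologicalSpace.nonempty_of_mem_countableBasis i.1.2) _)
  have ho2 := IsGδ.iInter_of_isOpen
    (f := fun i : TopologicalSpace.countableBasis X × ℕ =>
      {G : ℕ → C(ℕ → Bool, X) | ∃ j ≥ i.2, range (G j) ⊆ i.1})
    (fun i => isOpen_exists_range_subset (TopologicalSpace.isOpen_of_mem_countableBasis i.1.2) _)
  obtain ⟨G, hG1, hG2⟩ := (Dense.inter_of_Gδ ho1 ho2 h1 h2).nonempty
  rw [mem_iInter] at hG1 hG2
  refine ⟨G, fun U hU ⟨u, hu⟩ N => ?_, fun A hA φ l ε hε => ?_⟩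
  · obtain ⟨V, hV, -, hVU⟩ :=
      (TopologicalSpace.isBasis_countableBasis X).exists_subset_of_mem_open hu hU
    obtain ⟨j, hj, hjV⟩ := hG2 (⟨V, hV⟩, N)
    exact ⟨j, hj, hjV.trans hVU⟩
  · refine frequently_atTopIn.2 fun N => ?_
    obtain ⟨p, hp⟩ := exists_nat_one_div_lt (half_pos hε)
    -- Only countably many targets `D k` were imposed; an arbitrary `φ` is approximated by one of
    -- them in the coordinates up to `l`.
    have hopen : IsOpen (⋂ j ∈ Iic l, {ψ : ℕ → C(ℕ → Bool, X) | dist (ψ j) (φ j) < ε / 2}) :=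
      (finite_Iic l).isOpen_biInter fun j _ =>
        isOpen_lt ((continuous_apply j).dist continuous_const) continuous_const
    obtain ⟨k, hk⟩ := (TopologicalSpace.denseRange_denseSeq _).exists_mem_open hopen
      ⟨φ, by simp [hε]⟩
    obtain ⟨n, hnN, hnA, hn⟩ := hG1 (⟨A, hA⟩, k, l, N, p)
    refine ⟨n, hnN, hnA, fun j hj t => ?_⟩
    have h3 := hn j hj t
    have h4 : dist (D k j) (φ j) < ε / 2 := mem_iInter₂.1 hk j hj
    have h5 := (ContinuousMap.dist_lt_iff (half_pos hε)).1 h4 t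
    calc dist (f^[n] (G j t)) (φ j t) ≤ dist (f^[n] (G j t)) (D k j t) + dist (D k j t) (φ j t) :=
          dist_triangle _ _ _
      _ < ε := by linarith

/-! ### Iterates, invariant hulls and positivity of the displacement -/

theorem iterate_comm_apply {X : Type*} (f : X → X) (n i : ℕ) (c : X) :
    f^[n] (f^[i] c) = f^[i] (f^[n] c) := by
  rw [← Function.iterate_add_apply, add_comm, Function.iterate_add_apply]

theorem subset_invariantHull {X : Type*} (f : X → X) (S : Set X) : S ⊆ invariantHull f S :=
  fun c hc => mem_iUnion.2 ⟨0, c, hc, rfl⟩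

theorem mapsTo_invariantHull {X : Type*} (f : X → X) (S : Set X) :
    MapsTo f (invariantHull f S) (invariantHull f S) := fun p hp => by
  obtain ⟨i, c, hc, rfl⟩ := mem_iUnion.1 hp
  exact mem_iUnion.2 ⟨i + 1, c, hc, Function.iterate_succ_apply' f i c⟩

theorem IsMixing.denseRange_iterate (hmix : IsMixing f) (i : ℕ) : DenseRange f^[i] := by
  refine dense_iff_inter_open.2 fun V hV hV' => ?_
  have hne : Nonempty X := hV'.to_type
  obtain ⟨n, ⟨x, -, hx⟩, hn⟩ :=
    ((hmix.eventually isOpen_univ univ_nonempty hV hV').and (eventually_ge_atTop i)).exists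
  refine ⟨_, hx, f^[n - i] x, ?_⟩
  rw [← Function.iterate_add_apply, Nat.add_sub_cancel' hn]

/-- If `f^[n]` were the identity, arbitrarily late iterates would fix every point and could not
carry a point of `U` into a disjoint `V`. -/
theorem IsMixing.iSup_edist_iterate_pos (hmix : IsMixing f) [Nontrivial X] {n : ℕ} (hn : 1 ≤ n) :
    0 < ⨆ x, edist (f^[n] x) x := by
  refine pos_iff_ne_zero.2 fun h => ?_
  have hid : ∀ x, f^[n] x = x := fun x => edist_eq_zero.1 (ENNReal.iSup_eq_zero.1 h x)
  obtain ⟨a, b, hab⟩ := exists_pair_ne X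
  obtain ⟨U, V, hU, hV, haU, hbV, hUV⟩ := t2_separation hab
  obtain ⟨N, hN⟩ := eventually_atTop.1 (hmix.eventually hU ⟨a, haU⟩ hV ⟨b, hbV⟩)
  obtain ⟨x, hxU, hxV⟩ := hN (n * N) (Nat.le_mul_of_pos_left N hn)
  rw [Function.iterate_mul, show f^[n] = id from funext hid, Function.iterate_id] at hxV
  exact disjoint_left.1 hUV hxU hxV

/-- Mixing between two open sets at distance at least `r` bounds the displacement of all late
iterates below by `r`; each of the finitely many others has positive displacement. -/
theorem IsMixing.displacement_pos (hmix : IsMixing f) [Nontrivial X] : 0 < displacement f := by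
  obtain ⟨a, b, hab⟩ := exists_pair_ne X
  obtain ⟨r, hr0, hr⟩ := exists_between (edist_pos.2 hab)
  have hopen : IsOpen {p : X × X | r < edist p.2 p.1} :=
    isOpen_lt continuous_const (by fun_prop)
  obtain ⟨U, V, hU, haU, hV, hbV, hUV⟩ := mem_nhds_prod_iff'.1
    (hopen.mem_nhds (show (a, b) ∈ _ by rwa [mem_ofPred_eq, edist_comm]))
  obtain ⟨N, hN⟩ := eventually_atTop.1 (hmix.eventually hU ⟨a, haU⟩ hV ⟨b, hbV⟩)
  have hfin : ∃ s > 0, ∀ n < N, 1 ≤ n → s ≤ ⨆ x, edist (f^[n] x) x := by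
    clear hN
    induction N with
    | zero => exact ⟨1, one_pos, fun n hn => absurd hn (Nat.not_lt_zero n)⟩
    | succ N ih =>
      obtain ⟨s, hs, hsN⟩ := ih
      rcases Nat.eq_zero_or_pos N with rfl | hN
      · exact ⟨1, one_pos, fun n hn h1 => by omega⟩
      refine ⟨min s (⨆ x, edist (f^[N] x) x), lt_min hs (hmix.iSup_edist_iterate_pos hN),
        fun n hn h1 => ?_⟩
      rcases (Nat.lt_succ_iff_lt_or_eq.1 hn) with h | rfl
      · exact (min_le_left _ _).trans (hsN n h h1)
      · exact min_le_right _ _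
  obtain ⟨s, hs, hsN⟩ := hfin
  refine (lt_min hr0 hs).trans_le (le_iInf₂ fun n hn => ?_)
  rcases lt_or_ge n N with h | h
  · exact (min_le_right _ _).trans (hsN n h hn)
  · obtain ⟨x, hxU, hxV⟩ := hN n h
    have : r < edist (f^[n] x) x := hUV (show (x, f^[n] x) ∈ U ×ˢ V from ⟨hxU, hxV⟩)
    exact (min_le_left _ _).trans (this.le.trans (le_iSup (fun x => edist (f^[n] x) x) x))

/-! ### Scrambled pairs and convergence along sets of exponents -/

theorem liminf_edist_eq_zero {l : Filter ℕ} {u w : ℕ → X}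
    (h : ∀ ε : ℝ, 0 < ε → ∃ᶠ n in l, dist (u n) (w n) < ε) :
    liminf (fun n => edist (u n) (w n)) l = 0 := by
  refine nonpos_iff_eq_zero.1 (ENNReal.le_of_forall_pos_le_add fun ε hε _ => ?_)
  rw [zero_add]
  refine liminf_le_of_frequently_le' ((h ε (by exact_mod_cast hε)).mono fun n hn => ?_)
  rw [edist_dist, ← ENNReal.ofReal_coe_nnreal]
  exact ENNReal.ofReal_le_ofReal hn.le

theorem le_limsup_edist {l : Filter ℕ} {u w : ℕ → X} {b : ℝ≥0∞}
    (h : ∀ r < b, ∃ᶠ n in l, r < edist (u n) (w n)) :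
    b ≤ limsup (fun n => edist (u n) (w n)) l :=
  le_of_forall_lt fun r hr => by
    obtain ⟨s, hrs, hs⟩ := exists_between hr
    exact hrs.trans_le (le_limsup_of_frequently_le' ((h s hs).mono fun n hn => hn.le))

theorem exists_lt_edist {r : ℝ≥0∞} (hr : r < spaceDiam X) : ∃ a b : X, r < edist a b := by
  by_contra! h
  exact hr.not_ge (Metric.ediam_le fun a _ b _ => h a b)

theorem displacement_le_spaceDiam (f : X → X) : displacement f ≤ spaceDiam X :=
  (iInf₂_le 1 le_rfl).trans
    (iSup_le fun _ => Metric.edist_le_ediam_of_mem (mem_univ _) (mem_univ _))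

theorem spaceDiam_pos [Nontrivial X] : 0 < spaceDiam X :=
  Metric.ediam_pos_iff.2 nontrivial_univ

theorem IsScrambledPair.mono {l l' : Filter ℕ} {β : ℝ≥0∞} {x y : X}
    (h : IsScrambledPair f l β x y) (hl : l ≤ l') : IsScrambledPair f l' β x y :=
  ⟨nonpos_iff_eq_zero.1 ((liminf_le_liminf_of_le hl).trans h.1.le),
    h.2.trans (limsup_le_limsup_of_le hl)⟩

theorem IsScrambledPair.symm {l : Filter ℕ} {β : ℝ≥0∞} {x y : X}
    (h : IsScrambledPair f l β x y) : IsScrambledPair f l β y x := by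
  unfold IsScrambledPair at *
  simpa only [edist_comm] using h

theorem IsScrambledPair.ne {l : Filter ℕ} {β : ℝ≥0∞} (hβ : 0 < β) {x y : X}
    (h : IsScrambledPair f l β x y) : x ≠ y := by
  rintro rfl
  refine (hβ.trans_le h.2).ne' (nonpos_iff_eq_zero.1 (limsup_le_of_le (h := ?_)))
  simp

theorem IsScrambledPair.isScrambled_pair {β : ℝ≥0∞} (hβ : 0 < β) {x y : X}
    (h : IsScrambledPair f atTop β x y) : IsScrambled f β {x, y} := by
  refine ⟨nontrivial_pair (h.ne hβ), ?_⟩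
  rintro a (rfl | rfl) b (rfl | rfl) hab
  · exact absurd rfl hab
  · exact h
  · exact h.symm
  · exact absurd rfl hab

/-- Along the factorials, pairs scrambled for `f` are scrambled for every iterate of `f`. -/
theorem IsScrambledPair.iterate_of_factorial {β : ℝ≥0∞} {x y : X}
    (h : IsScrambledPair f (atTopIn {k | ∃ n : ℕ, 1 ≤ n ∧ k = n.factorial}) β x y)
    {n : ℕ} (hn : 1 ≤ n) : IsScrambledPair f^[n] atTop β x y := by
  -- Factorials that are at least `n!` are multiples of `n`, hence are exponents of iterates of
  -- `f^[n]`.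
  have hle : atTopIn {k | ∃ n : ℕ, 1 ≤ n ∧ k = n.factorial} ≤ map (n * ·) atTop := by
    intro s hs
    obtain ⟨K, hK⟩ := mem_atTop_sets.1 (mem_map.1 hs)
    change ∀ᶠ j in atTop ⊓ 𝓟 _, j ∈ s
    rw [eventually_inf_principal]
    filter_upwards [eventually_ge_atTop n.factorial, eventually_ge_atTop (n * K)]
    rintro _ h1 h2 ⟨m, hm, rfl⟩
    have hdvd : n ∣ m.factorial := by
      rcases le_total n m with hnm | hmn
      · exact Nat.dvd_factorial hn hnm
      · rw [le_antisymm (Nat.factorial_le hmn) h1]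
        exact Nat.dvd_factorial hn le_rfl
    obtain ⟨k, hk⟩ := hdvd
    rw [hk] at h2 ⊢
    exact hK k (Nat.le_of_mul_le_mul_left h2 hn)
  have h' := h.mono hle
  unfold IsScrambledPair at h' ⊢
  simp only [← Function.iterate_mul]
  exact h'

theorem IsOmegaLimitPoint.exists_tendsto {x y : X} (h : IsOmegaLimitPoint f x y) (i : ℕ) :
    ∃ A : Set ℕ, A.Infinite ∧ Tendsto (fun n => f^[n] (f^[i] x)) (atTopIn A) (𝓝 y) := by
  obtain ⟨k, hk, hky⟩ := h
  refine ⟨{n | n + i ∈ range k}, infinite_of_forall_exists_gt fun a => ?_, fun s hs => ?_⟩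
  · have := hk.le_apply (x := a + i + 1)
    exact ⟨k (a + i + 1) - i, ⟨a + i + 1, by omega⟩, by omega⟩
  · obtain ⟨Q, hQ⟩ := eventually_atTop.1 (hky hs)
    change ∀ᶠ n in atTop ⊓ 𝓟 _, f^[n] (f^[i] x) ∈ s
    rw [eventually_inf_principal]
    filter_upwards [eventually_ge_atTop (k Q)]
    rintro n hn ⟨q, hq⟩
    rw [← Function.iterate_add_apply, ← hq]
    exact hQ q (hk.le_iff_le.1 (by omega))

theorem exists_strictMono_tendsto_ediam {T : ℕ → Set X} {A : Set ℕ} {a : X}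
    (h : ∀ ε : ℝ, 0 < ε → ∃ᶠ n in atTopIn A, T n ⊆ Metric.ball a ε) :
    ∃ m : ℕ → ℕ, StrictMono m ∧ (∀ i, m i ∈ A) ∧ (∀ i, 0 < m i) ∧
      Tendsto (fun i => Metric.ediam (T (m i))) atTop (𝓝 0) := by
  have hfreq : ∀ p : ℕ, ∃ᶠ n in atTop,
      (n ∈ A ∧ T n ⊆ Metric.ball a (1 / ((p : ℝ) + 1))) ∧ 0 < n := fun p =>
    (frequently_inf_principal.1 (h _ Nat.one_div_pos_of_nat)).and_eventually
      (eventually_gt_atTop 0)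
  obtain ⟨m, hm, hP⟩ := extraction_forall_of_frequently hfreq
  refine ⟨m, hm, fun i => (hP i).1.1, fun i => (hP i).2, ?_⟩
  have hlim : Tendsto (fun p : ℕ => 2 * ENNReal.ofReal (1 / ((p : ℝ) + 1))) atTop (𝓝 0) := by
    have := ENNReal.Tendsto.const_mul (a := 2)
      (ENNReal.tendsto_ofReal (tendsto_one_div_add_atTop_nhds_zero_nat (𝕜 := ℝ)))
      (Or.inr (by simp))
    simpa using this
  refine tendsto_of_tendsto_of_tendsto_of_le_of_le tendsto_const_nhds hlim
    (fun _ => zero_le) fun i => ?_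
  refine (Metric.ediam_mono (hP i).1.2).trans ?_
  rw [← Metric.eball_ofReal]
  exact Metric.ediam_eball_le

theorem frequently_prod_mem_of_tendsto {l : Filter ℕ} {u w : ℕ → X} {y a : X}
    (hu : Tendsto u l (𝓝 y)) (hw : ∀ U : Set X, IsOpen U → U.Nonempty → ∃ᶠ n in l, w n ∈ U)
    {W : Set (X × X)} (hW : IsOpen W) (hya : (y, a) ∈ W) : ∃ᶠ n in l, (u n, w n) ∈ W := by
  obtain ⟨U, V, hU, hyU, hV, haV, hUV⟩ := mem_nhds_prod_iff'.1 (hW.mem_nhds hya)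
  exact ((hw V hV ⟨a, haV⟩).and_eventually (hu (hU.mem_nhds hyU))).mono
    fun n hn => hUV ⟨hn.2, hn.1⟩

/-- A point whose orbit, at times along which the orbit of `p` converges, frequently visits every
open set is scrambled with `p`. -/
theorem isScrambledPair_of_tendsto {l : Filter ℕ} {p c y : X}
    (hp : Tendsto (fun n => f^[n] p) l (𝓝 y))
    (hc : ∀ U : Set X, IsOpen U → U.Nonempty → ∃ᶠ n in l, f^[n] c ∈ U) :
    IsScrambledPair f l (spaceDiam X / 2) p c := by
  refine ⟨liminf_edist_eq_zero fun ε hε => ?_, le_limsup_edist fun r hr => ?_⟩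
  · exact frequently_prod_mem_of_tendsto hp hc (W := {q | dist q.1 q.2 < ε}) (a := y)
      (isOpen_lt (by fun_prop) continuous_const) (by simpa using hε)
  · have h2r : r + r < spaceDiam X := by
      rw [← ENNReal.add_halves (spaceDiam X)]
      exact ENNReal.add_lt_add hr hr
    obtain ⟨a, b, hab⟩ := exists_lt_edist h2r
    -- This is the origin of the factor 1/2: if all points lay within `r` of `y`, the distance from
    -- `a` to `b` would be at most `2r`.
    have : ∃ e : X, r < edist y e := by
      by_contra! h
      exact hab.not_ge ((edist_triangle_left a b y).trans (add_le_add (h a) (h b)))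
    obtain ⟨e, he⟩ := this
    exact frequently_prod_mem_of_tendsto hp hc (W := {q | r < edist q.1 q.2})
      (isOpen_lt continuous_const (by fun_prop)) he

/-! ### Dynamical consequences of shadowing -/

/-- Iterates of `f` with exponents in `A` bring the maps `G 0, …, G l` simultaneously and
uniformly close to any given maps. -/
def IsShadowing (f : X → X) (A : Set ℕ) (G : ℕ → C(ℕ → Bool, X)) : Prop :=
  ∀ (φ : ℕ → C(ℕ → Bool, X)) (l : ℕ) (ε : ℝ), 0 < ε →
    ∃ᶠ n in atTopIn A, ∀ j ≤ l, ∀ t, dist (f^[n] (G j t)) (φ j t) < ε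

namespace IsShadowing

variable {A : Set ℕ} {G : ℕ → C(ℕ → Bool, X)}

theorem frequently_dist_lt (h : IsShadowing f A G) (l : ℕ) (a : X) {ε : ℝ} (hε : 0 < ε) :
    ∃ᶠ n in atTopIn A, ∀ c ∈ ⋃ j ≤ l, range (G j), dist (f^[n] c) a < ε := by
  refine (h (fun _ => .const _ a) l ε hε).mono fun n hn c hc => ?_
  obtain ⟨j, hj, t, rfl⟩ := mem_iUnion₂.1 hc
  exact hn j hj t

theorem frequently_mem (h : IsShadowing f A G) {c : X} (hc : c ∈ ⋃ j, range (G j)) {U : Set X}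
    (hU : IsOpen U) (hU' : U.Nonempty) : ∃ᶠ n in atTopIn A, f^[n] c ∈ U := by
  obtain ⟨a, ha⟩ := hU'
  obtain ⟨ε, hε, hb⟩ := Metric.isOpen_iff.1 hU a ha
  obtain ⟨j, hj⟩ := mem_iUnion.1 hc
  exact (h.frequently_dist_lt j a hε).mono fun n hn => hb (hn c (mem_iUnion₂.2 ⟨j, le_rfl, hj⟩))

/-- Distinct parameters are separated by continuous `Bool`-valued maps: by a bit where `s` and `t`
differ if `j = k`, by different constants otherwise. Sending the two values to `a` and `b` gives a
target to shadow. -/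
theorem frequently_pair_mem (h : IsShadowing f A G) {j k : ℕ} {s t : ℕ → Bool}
    (hne : (j, s) ≠ (k, t)) {W : Set (X × X)} (hW : IsOpen W) (hW' : W.Nonempty) :
    ∃ᶠ n in atTopIn A, (f^[n] (G j s), f^[n] (G k t)) ∈ W := by
  obtain ⟨χ, hχj, hχk⟩ : ∃ χ : ℕ → C(ℕ → Bool, Bool), χ j s = true ∧ χ k t = false := by
    by_cases hjk : j = k
    · subst hjk
      obtain ⟨i, hi⟩ := Function.ne_iff.1 (fun hst : s = t => hne (by rw [hst]))
      refine ⟨fun _ => ⟨fun u => u i == s i, ?_⟩, by simp, by simpa using hi.symm⟩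
      exact (continuous_of_discreteTopology (f := fun b : Bool => b == s i)).comp
        (continuous_apply i)
    · exact ⟨fun m => .const _ (decide (m = j)), by simp, by simpa using Ne.symm hjk⟩
  obtain ⟨⟨a, b⟩, hab⟩ := hW'
  obtain ⟨ε, hε, hb⟩ := Metric.isOpen_iff.1 hW (a, b) hab
  let e : C(Bool, X) := ⟨fun c => if c then a else b, continuous_of_discreteTopology⟩
  refine (h (fun m => e.comp (χ m)) (max j k) ε hε).mono fun n hn => hb ?_
  rw [Metric.mem_ball, Prod.dist_eq]
  refine max_lt ?_ ?_
  · simpa [e, hχj] using hn j (le_max_left _ _) s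
  · simpa [e, hχk] using hn k (le_max_right _ _) t

theorem injective [Nontrivial X] (h : IsShadowing f A G) {j k : ℕ} {s t : ℕ → Bool}
    (hst : G j s = G k t) : (j, s) = (k, t) := by
  by_contra hne
  obtain ⟨a, b, hab⟩ := exists_pair_ne X
  obtain ⟨n, hn⟩ := (h.frequently_pair_mem hne (W := {p | p.1 ≠ p.2})
    (isOpen_ne_fun continuous_fst continuous_snd) ⟨(a, b), hab⟩).exists
  exact hn (by rw [hst])

theorem frequently_iterate_mem (h : IsShadowing f A G) (hf : Continuous f) (hmix : IsMixing f)
    {c : X} (hc : c ∈ ⋃ j, range (G j)) (i : ℕ) {U : Set X} (hU : IsOpen U) (hU' : U.Nonempty) :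
    ∃ᶠ n in atTopIn A, f^[n] (f^[i] c) ∈ U := by
  simp only [iterate_comm_apply f _ i]
  obtain ⟨a, ha⟩ := (hmix.denseRange_iterate i).exists_mem_open hU hU'
  exact h.frequently_mem hc (hU.preimage (hf.iterate i)) ⟨a, ha⟩

theorem frequently_iterate_pair_mem (h : IsShadowing f A G) (hf : Continuous f)
    (hmix : IsMixing f) {c d : X} (hc : c ∈ ⋃ j, range (G j)) (hd : d ∈ ⋃ j, range (G j))
    (hcd : c ≠ d) (i k : ℕ) {W : Set (X × X)} (hW : IsOpen W) (hW' : W.Nonempty) :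
    ∃ᶠ n in atTopIn A, (f^[n] (f^[i] c), f^[n] (f^[k] d)) ∈ W := by
  simp only [iterate_comm_apply f _ i, iterate_comm_apply f _ k]
  -- Since iterates commute, `W` can be pulled back along `f^[i] × f^[k]`; dense range keeps the
  -- preimage nonempty.
  obtain ⟨a, ha⟩ := ((hmix.denseRange_iterate i).prodMap
    (hmix.denseRange_iterate k)).exists_mem_open hW hW'
  obtain ⟨j, s, rfl⟩ := mem_iUnion.1 hc
  obtain ⟨m, t, rfl⟩ := mem_iUnion.1 hd
  refine h.frequently_pair_mem (fun hjm => hcd ?_)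
    (hW.preimage ((hf.iterate i).prodMap (hf.iterate k))) ⟨a, ha⟩
  rw [(Prod.mk.inj hjm).1, (Prod.mk.inj hjm).2]

theorem spaceDiam_le_limsup (h : IsShadowing f A G) (hf : Continuous f)
    (hmix : IsMixing f) {c d : X} (hc : c ∈ ⋃ j, range (G j)) (hd : d ∈ ⋃ j, range (G j))
    (hcd : c ≠ d) (i k : ℕ) :
    spaceDiam X ≤ limsup (fun n => edist (f^[n] (f^[i] c)) (f^[n] (f^[k] d))) (atTopIn A) := by
  refine le_limsup_edist fun r hr => ?_
  obtain ⟨a, b, hab⟩ := exists_lt_edist hr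
  exact h.frequently_iterate_pair_mem hf hmix hc hd hcd i k (W := {p | r < edist p.1 p.2})
    (isOpen_lt continuous_const (by fun_prop)) ⟨(a, b), hab⟩

/-- For `r` below the displacement, the points that `f^[p]` moves by more than `r` form a nonempty
open set, which the orbit of `f^[i] c` visits infinitely often along `A`. -/
theorem displacement_le_limsup (h : IsShadowing f A G) (hf : Continuous f)
    (hmix : IsMixing f) {c : X} (hc : c ∈ ⋃ j, range (G j)) (i : ℕ) {p : ℕ} (hp : 1 ≤ p) :
    displacement f ≤
      limsup (fun n => edist (f^[n] (f^[i + p] c)) (f^[n] (f^[i] c))) (atTopIn A) := by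
  refine le_limsup_edist fun r hr => ?_
  obtain ⟨a, ha⟩ := lt_iSup_iff.1 (hr.trans_le (iInf₂_le p hp))
  have := h.frequently_iterate_mem hf hmix hc i (U := {q | r < edist (f^[p] q) q})
    (isOpen_lt continuous_const ((hf.iterate p).edist continuous_id)) ⟨a, ha⟩
  refine this.mono fun n hn => ?_
  rw [mem_ofPred_eq] at hn
  rwa [add_comm i p, Function.iterate_add_apply, iterate_comm_apply f n p]

/-- By continuity at the fixed point, once `f^[n] c` and `f^[n] d` are close enough to `z`, so are
their images under `f^[i]` and `f^[k]`. -/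
theorem frequently_dist_iterate_lt (h : IsShadowing f A G) {z : X} (hf : Continuous f)
    (hz : Function.IsFixedPt f z) {c d : X} (hc : c ∈ ⋃ j, range (G j))
    (hd : d ∈ ⋃ j, range (G j)) (i k : ℕ) {ε : ℝ} (hε : 0 < ε) :
    ∃ᶠ n in atTopIn A, dist (f^[n] (f^[i] c)) (f^[n] (f^[k] d)) < ε := by
  have hnhds : ∀ i, f^[i] ⁻¹' Metric.ball z (ε / 2) ∈ 𝓝 z := fun i =>
    (hf.iterate i).continuousAt.preimage_mem_nhds
      (by rw [(hz.iterate i).eq]; exact Metric.ball_mem_nhds z (half_pos hε))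
  obtain ⟨δ, hδ, hsub⟩ := Metric.mem_nhds_iff.1 (inter_mem (hnhds i) (hnhds k))
  obtain ⟨j, hj⟩ := mem_iUnion.1 hc
  obtain ⟨m, hm⟩ := mem_iUnion.1 hd
  refine (h.frequently_dist_lt (max j m) z hδ).mono fun n hn => ?_
  have h1 := (hsub (hn c (mem_iUnion₂.2 ⟨j, le_max_left _ _, hj⟩))).1
  have h2 := (hsub (hn d (mem_iUnion₂.2 ⟨m, le_max_right _ _, hm⟩))).2
  rw [iterate_comm_apply f n i, iterate_comm_apply f n k]
  rw [mem_preimage, Metric.mem_ball] at h1 h2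
  calc _ ≤ dist (f^[i] (f^[n] c)) z + dist (f^[k] (f^[n] d)) z := dist_triangle_right _ _ _
    _ < ε := by linarith

theorem isScrambledPair_hull (h : IsShadowing f A G) (hf : Continuous f) (hmix : IsMixing f)
    {z : X} (hz : Function.IsFixedPt f z) {p q : X}
    (hp : p ∈ invariantHull f (⋃ j, range (G j))) (hq : q ∈ invariantHull f (⋃ j, range (G j)))
    (hpq : p ≠ q) : IsScrambledPair f (atTopIn A) (displacement f) p q := by
  obtain ⟨i, c, hc, rfl⟩ := mem_iUnion.1 hp
  obtain ⟨k, d, hd, rfl⟩ := mem_iUnion.1 hq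
  refine ⟨liminf_edist_eq_zero fun ε hε =>
    h.frequently_dist_iterate_lt hf hz hc hd i k hε, ?_⟩
  -- Two points of one orbit are only known to separate by the displacement; points from different
  -- orbits separate by the full diameter.
  by_cases hcd : c = d
  · subst hcd
    rcases lt_trichotomy i k with hik | rfl | hik
    · obtain ⟨e, rfl⟩ := Nat.exists_eq_add_of_lt hik
      have := h.displacement_le_limsup hf hmix hc i (p := e + 1) (by omega)
      simpa only [edist_comm, add_assoc] using this
    · exact absurd rfl hpq
    · obtain ⟨e, rfl⟩ := Nat.exists_eq_add_of_lt hik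
      exact h.displacement_le_limsup hf hmix hc k (p := e + 1) (by omega)
  · exact (displacement_le_spaceDiam f).trans (h.spaceDiam_le_limsup hf hmix hc hd hcd i k)

end IsShadowing

/-! ### Construction of the Cantor family -/

theorem isCantorSet_range {g : C(ℕ → Bool, X)} (hg : Function.Injective g) :
    IsCantorSet (range g) := by
  have hemb : IsClosedEmbedding g := g.continuous.isClosedEmbedding hg
  refine ⟨range_nonempty g, isCompact_range g.continuous, ⟨hemb.isClosed_range, ?_⟩,
    hemb.isEmbedding.isTotallyDisconnected_range.2 inferInstance⟩
  rw [preperfect_iff_nhds]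
  rintro _ ⟨t, rfl⟩ U hU
  obtain ⟨_, ⟨y, n, rfl⟩, hty, hsub⟩ :=
    (PiNat.isTopologicalBasis_cylinders (fun _ : ℕ => Bool)).mem_nhds_iff.1
      (g.continuous.continuousAt.preimage_mem_nhds hU)
  rw [← PiNat.mem_cylinder_iff_eq.1 hty] at hsub
  refine ⟨g (Function.update t n (!t n)),
    ⟨hsub (PiNat.update_mem_cylinder t n _), mem_range_self _⟩, fun h => ?_⟩
  simpa using congrFun (hg h) n

theorem infinite_setOf_multiples {n : ℕ} (hn : 1 ≤ n) : {k : ℕ | n ∣ k}.Infinite :=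
  infinite_of_forall_exists_gt fun a =>
    ⟨n * (a + 1), dvd_mul_right _ _, (Nat.lt_succ_self a).trans_le (Nat.le_mul_of_pos_left _ hn)⟩

theorem isTotallyTransitivePoint_of_frequently {c : X}
    (h : ∀ n : ℕ, 1 ≤ n → ∀ U : Set X, IsOpen U → U.Nonempty →
      ∃ᶠ k in atTopIn {k | n ∣ k}, f^[k] c ∈ U) : IsTotallyTransitivePoint f c := by
  refine fun n hn => dense_iff_inter_open.2 fun U hU hU' => ?_
  obtain ⟨_, -, ⟨k, rfl⟩, hk⟩ := frequently_atTopIn.1 (h n hn U hU hU') 0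
  exact ⟨_, hk, k, by rw [Function.iterate_mul]⟩

variable [LocallyCompactSpace X] [TopologicalSpace.SeparableSpace X]

theorem IsMixing.exists_family (hmix : IsMixing f) (hf : Continuous f) [Nontrivial X] {M : Set ℕ}
    (hM : M.Infinite) (v : ℕ → X) {x : ℕ → X} (hx : ∀ m, ∃ y, IsOmegaLimitPoint f (x m) y) :
    ∃ G : ℕ → C(ℕ → Bool, X), IsShadowing f M G ∧
      IsScrambledCantorFamily f M v x fun j => range (G j) := by
  choose y hy using hx
  choose A hAinf hA using fun m i => (hy m).exists_tendsto i
  -- Three kinds of exponents: `M` itself, the multiples of each `n ≥ 1` for total transitivity, and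
  -- the times `A m i` along which the orbit of `f^[i] (x m)` converges to `y m`.
  obtain ⟨G, hGU, hG⟩ := hmix.exists_generic hf
    (𝒜 := insert M ((range fun i : {n : ℕ // 1 ≤ n} => {k : ℕ | (i : ℕ) ∣ k}) ∪
      range fun p : ℕ × ℕ => A p.1 p.2))
    (((countable_range _).union (countable_range _)).insert M) (by
      rintro B (rfl | ⟨⟨n, hn⟩, rfl⟩ | ⟨p, rfl⟩)
      · exact hM
      · exact infinite_setOf_multiples hn
      · exact hAinf _ _)
  have hGM : IsShadowing f M G := hG M (mem_insert _ _)
  have hGn : ∀ n, 1 ≤ n → IsShadowing f {k | n ∣ k} G := fun n hn =>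
    hG _ (Or.inr (Or.inl ⟨⟨n, hn⟩, rfl⟩))
  have hGA : ∀ m i, IsShadowing f (A m i) G := fun m i => hG _ (Or.inr (Or.inr ⟨(m, i), rfl⟩))
  have hinj : ∀ j, Function.Injective (G j) := fun j s t hst => (Prod.mk.inj (hGM.injective hst)).2
  have hdense : Dense (⋃ j, range (G j)) := dense_iff_inter_open.2 fun U hU hU' => by
    obtain ⟨j, -, hj⟩ := hGU U hU hU' 0
    exact ⟨G j fun _ => false, hj (mem_range_self _), mem_iUnion.2 ⟨j, mem_range_self _⟩⟩
  have hnontriv : (⋃ j, range (G j)).Nontrivial :=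
    ⟨G 0 fun _ => false, mem_iUnion.2 ⟨0, mem_range_self _⟩, G 1 fun _ => false,
      mem_iUnion.2 ⟨1, mem_range_self _⟩,
      fun h => absurd (Prod.mk.inj (hGM.injective h)).1 zero_ne_one⟩
  have hpair : ∀ p ∈ invariantHull f (range x), ∀ c ∈ invariantHull f (⋃ j, range (G j)),
      IsScrambledPair f atTop (spaceDiam X / 2) p c := by
    intro p hp c hc
    obtain ⟨i, _, ⟨m, rfl⟩, rfl⟩ := mem_iUnion.1 hp
    obtain ⟨k, d, hd, rfl⟩ := mem_iUnion.1 hc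
    exact (isScrambledPair_of_tendsto (hA m i) fun U hU hU' =>
      (hGA m i).frequently_iterate_mem hf hmix hd k hU hU').mono inf_le_left
  refine ⟨G, hGM, ?_⟩
  refine
    { cantor := fun j => isCantorSet_range (hinj j)
      pairwise_disjoint := fun i j hij => disjoint_left.2 ?_
      totallyTransitive := fun j c hc => isTotallyTransitivePoint_of_frequently fun n hn U hU hU' =>
        (hGn n hn).frequently_mem (mem_iUnion.2 ⟨j, hc⟩) hU hU'
      infinite_in_open := fun U hU hU' => infinite_of_forall_exists_gt fun N => ?_
      syncProximal := fun l m => ?_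
      dynSyncProximal := fun l m i => ?_
      dense := hdense
      scrambled := ⟨hnontriv, fun c hc d hd hcd => ⟨?_, ?_⟩⟩
      scrambled_with := fun p hp c hc => ⟨hpair p hp c hc,
        (hpair p hp c hc).isScrambled_pair (ENNReal.half_pos spaceDiam_pos.ne')⟩
      limsup_eq := fun c hc d hd hcd i => le_antisymm (limsup_le_of_le (h := ?_))
        (hGM.spaceDiam_le_limsup hf hmix hc hd hcd i i) }
  · rintro _ ⟨s, rfl⟩ ⟨t, ht⟩
    exact hij (Prod.mk.inj (hGM.injective ht)).1.symm
  · obtain ⟨j, hj, hjU⟩ := hGU U hU hU' (N + 1)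
    exact ⟨j, hjU, hj⟩
  · obtain ⟨k, hk, hkM, -, hlim⟩ := exists_strictMono_tendsto_ediam
      (T := fun n => f^[n] '' (⋃ j ≤ l, range (G j)) ∪ {v m}) (A := M) (a := v m) fun ε hε =>
        (hGM.frequently_dist_lt l (v m) hε).mono fun n hn => by
          rintro _ (⟨c, hc, rfl⟩ | rfl)
          · exact hn c hc
          · exact Metric.mem_ball_self hε
    exact ⟨k, hk, hkM, hlim⟩
  · obtain ⟨k, hk, -, hpos, hlim⟩ := exists_strictMono_tendsto_ediam
      (T := fun n => f^[n] '' ((⋃ j ≤ l, range (G j)) ∪ {f^[i] (x m)})) (A := A m i) (a := y m)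
      fun ε hε => (((hGA m i).frequently_dist_lt l (y m) hε).and_eventually
        (hA m i (Metric.ball_mem_nhds _ hε))).mono fun n hn => by
          rintro _ ⟨c, hc | rfl, rfl⟩
          · exact hn.1 c hc
          · exact hn.2
    exact ⟨k, hk, hpos, hlim⟩
  · refine liminf_edist_eq_zero fun ε hε => ?_
    obtain ⟨j, hj⟩ := mem_iUnion.1 hc
    obtain ⟨m, hm⟩ := mem_iUnion.1 hd
    -- Any common target would do; `c` is merely a convenient point.
    refine (hGM.frequently_dist_lt (max j m) c (half_pos hε)).mono fun n hn => ?_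
    have h1 := hn c (mem_iUnion₂.2 ⟨j, le_max_left _ _, hj⟩)
    have h2 := hn d (mem_iUnion₂.2 ⟨m, le_max_right _ _, hm⟩)
    calc _ ≤ dist (f^[n] c) c + dist (f^[n] d) c := dist_triangle_right _ _ _
      _ < ε := by linarith
  · exact hGM.spaceDiam_le_limsup hf hmix hc hd hcd 0 0
  · exact Eventually.of_forall fun n => Metric.edist_le_ediam_of_mem (mem_univ _) (mem_univ _)

/-- If there is a fixed point, the invariant hull of the family is scrambled as well. -/
theorem IsMixing.exists_family_of_isFixedPt (hmix : IsMixing f) (hf : Continuous f) [Nontrivial X]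
    {M : Set ℕ} (hM : M.Infinite) (v : ℕ → X) {x : ℕ → X}
    (hx : ∀ m, ∃ y, IsOmegaLimitPoint f (x m) y) {z : X} (hz : Function.IsFixedPt f z) :
    ∃ S : ℕ → Set X, IsScrambledCantorFamily f M v x S ∧ Dense (invariantHull f (⋃ j, S j)) ∧
      MapsTo f (invariantHull f (⋃ j, S j)) (invariantHull f (⋃ j, S j)) ∧
      IsScrambledWrt f M (displacement f) (invariantHull f (⋃ j, S j)) := by
  obtain ⟨G, hG, hS⟩ := hmix.exists_family hf hM v hx
  exact ⟨_, hS, hS.dense.mono (subset_invariantHull f _), mapsTo_invariantHull f _,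
    hS.scrambled.1.mono (subset_invariantHull f _), fun p hp q hq hpq =>
      hG.isScrambledPair_hull hf hmix hz hp hq hpq⟩

theorem infinite_setOf_factorial : {k | ∃ n : ℕ, 1 ≤ n ∧ k = n.factorial}.Infinite :=
  infinite_of_forall_exists_gt fun a =>
    ⟨(a + 1).factorial, ⟨a + 1, by omega, rfl⟩,
      (Nat.lt_succ_self a).trans_le (Nat.self_le_factorial _)⟩

end MixingChaos

theorem theorem16 {X : Type*} [MetricSpace X] [Infinite X] [TopologicalSpace.SeparableSpace X]
    [LocallyCompactSpace X] (f : X → X) (hf : Continuous f) (hmix : MixingChaos.IsMixing f)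
    (M : Set ℕ) (hM : M.Infinite) (hMpos : ∀ n ∈ M, 0 < n)
    (v x : ℕ → X) (hx : ∀ m, ∃ y, MixingChaos.IsOmegaLimitPoint f (x m) y) :
    0 < MixingChaos.displacement f ∧
    (∃ S : ℕ → Set X, MixingChaos.IsScrambledCantorFamily f M v x S) ∧
    ((∃ z, Function.IsFixedPt f z) →
      ∃ S : ℕ → Set X, MixingChaos.IsScrambledCantorFamily f M v x S ∧
        Dense (MixingChaos.invariantHull f (⋃ j, S j)) ∧
        MapsTo f (MixingChaos.invariantHull f (⋃ j, S j))
          (MixingChaos.invariantHull f (⋃ j, S j)) ∧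
        MixingChaos.IsScrambledWrt f M (MixingChaos.displacement f)
          (MixingChaos.invariantHull f (⋃ j, S j))) ∧
    ((∃ z, Function.IsFixedPt f z) →
      ∃ S : ℕ → Set X,
        MixingChaos.IsScrambledCantorFamily f {k | ∃ n : ℕ, 1 ≤ n ∧ k = n.factorial} v x S ∧
        ∀ n : ℕ, 1 ≤ n →
          Dense (⋃ j, S j) ∧
          MixingChaos.IsScrambled (f^[n]) (MixingChaos.spaceDiam X) (⋃ j, S j) ∧
          Dense (MixingChaos.invariantHull f (⋃ j, S j)) ∧
          MapsTo (f^[n]) (MixingChaos.invariantHull f (⋃ j, S j))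
            (MixingChaos.invariantHull f (⋃ j, S j)) ∧
          MixingChaos.IsScrambled (f^[n]) (MixingChaos.displacement f)
            (MixingChaos.invariantHull f (⋃ j, S j))) := by
  refine ⟨hmix.displacement_pos, ?_, ?_, ?_⟩
  · obtain ⟨G, -, hS⟩ := hmix.exists_family hf hM v hx
    exact ⟨_, hS⟩
  · rintro ⟨z, hz⟩
    exact hmix.exists_family_of_isFixedPt hf hM v hx hz
  · rintro ⟨z, hz⟩
    obtain ⟨S, hS, hdense, hmaps, hscr⟩ :=
      hmix.exists_family_of_isFixedPt hf MixingChaos.infinite_setOf_factorial v hx hz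
    exact ⟨S, hS, fun n hn => ⟨hS.dense,
      ⟨hS.scrambled.1, fun c hc d hd hcd =>
        (hS.scrambled.2 c hc d hd hcd).iterate_of_factorial hn⟩,
      hdense, hmaps.iterate n,
      ⟨hscr.1, fun p hp q hq hpq => (hscr.2 p hp q hq hpq).iterate_of_factorial hn⟩⟩⟩
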